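/- Let $n\ge 2$ and let $\mathbb{H}^n$ be hyperbolic space of constant curvature $-1$ with its distance function $d(\cdot,\cdot)$. Let $N_1,N_2$ be smooth $(n-1)$-dimensional manifolds without boundary, $N_1$ compact, and let $F_k:N_k\times[0,T)\to\mathbb{H}^n$ ($k=1,2$) be smooth families of immersions that evolve by mean curvature flow, $$\partial_t F_k=-H\nu ,$$ where $\nu$ is a unit normal and $H=\frac{1}{n-1}(\kappa_1+\dots+\kappa_{n-1})$ is the mean curvature with respect to $\nu$, i.e. the average of the principal curvatures, with the sign for which geodesic spheres have $H>0$ with respect to the outer normal (the vector $H\nu$ does not depend on the choice of $\nu$). Suppose that the second flow, which need not be compact, is proper, i.e. the map $(x,t)\mapsto(F_2(x,t),t)$ from $N_2\times[0,T)$ to $\mathbb{H}^n\times[0,T)$ is proper. Put $\Sigma^k_t=F_k(N_k,t)$ and $$d(t)=\inf_{p\in\Sigma^1_t,\ q\in\Sigma^2_t} d(p,q).$$ Then for every $t\in[0,T)$ $$e^{t}\sinh\frac{d(t)}{2}\ \ge\ \sinh\frac{d(0)}{2},$$ and in particular $e^{t}\,d(t)\ge d(0)$. -/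

import Mathlib

open scoped Manifold ContDiff

noncomputable section

namespace HypMCF

/-- Minkowski space `ℝ^{1,n}`: a time coordinate and `n` space coordinates. -/
abbrev Minkowski (n : ℕ) : Type := ℝ × EuclideanSpace ℝ (Fin n)

/-- The Lorentzian inner product `⟨x, y⟩ = x₁ y₁ + ⋯ + xₙ yₙ - x₀ y₀`. -/
def lor {n : ℕ} (x y : Minkowski n) : ℝ := inner ℝ x.2 y.2 - x.1 * y.1

/-- Hyperbolic space `ℍⁿ` of constant curvature `-1`, as the upper sheet of the hyperboloid
`⟨p, p⟩ = -1`. Its tangent space at `p` is `{v | ⟨p, v⟩ = 0}`, and its Riemannian metric is the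
restriction of the Lorentzian inner product to the tangent spaces. -/
def hyperbolicSpace (n : ℕ) : Set (Minkowski n) := {p | lor p p = -1 ∧ 0 < p.1}

/-- The hyperbolic distance: `cosh d(p, q) = -⟨p, q⟩`. -/
def hdist {n : ℕ} (p q : Minkowski n) : ℝ := Real.arcosh (-lor p q)

/-- The distance `inf {d(p, q) | p ∈ A, q ∈ B}` between two subsets of `ℍⁿ`. -/
def setDist {n : ℕ} (A B : Set (Minkowski n)) : ℝ :=
  sInf {r | ∃ p ∈ A, ∃ q ∈ B, r = hdist p q}

section Hypersurface

variable {m : ℕ} {N : Type*} [TopologicalSpace N] [ChartedSpace (EuclideanSpace ℝ (Fin m)) N]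

/-- The map `f` read in the preferred chart of `N` around `x`. -/
def localRep (f : N → Minkowski (m + 1)) (x : N) : EuclideanSpace ℝ (Fin m) → Minkowski (m + 1) :=
  f ∘ (extChartAt (𝓡 m) x).symm

/-- The partial derivative `∂ᵢ f` at `x`, in the preferred chart around `x`. -/
def partialD (f : N → Minkowski (m + 1)) (x : N) (i : Fin m) : Minkowski (m + 1) :=
  fderiv ℝ (localRep f x) (extChartAt (𝓡 m) x x) (EuclideanSpace.single i 1)

/-- The second partial derivative `∂ᵢ ∂ⱼ f` at `x`, in the preferred chart around `x`. -/
def partialDD (f : N → Minkowski (m + 1)) (x : N) (i j : Fin m) : Minkowski (m + 1) :=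
  fderiv ℝ (fderiv ℝ (localRep f x)) (extChartAt (𝓡 m) x x)
    (EuclideanSpace.single i 1) (EuclideanSpace.single j 1)

/-- The induced metric (first fundamental form) `gᵢⱼ = ⟨∂ᵢ f, ∂ⱼ f⟩`. -/
def firstFF (f : N → Minkowski (m + 1)) (x : N) : Matrix (Fin m) (Fin m) ℝ :=
  Matrix.of fun i j => lor (partialD f x i) (partialD f x j)

/-- `ν` is a unit normal of the hypersurface `f : N → ℍ^{m+1}` at `x`: a unit vector, tangent to
`ℍ^{m+1}` at `f x` and orthogonal to the image of the differential of `f`. -/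
structure IsUnitNormal (f : N → Minkowski (m + 1)) (x : N) (ν : Minkowski (m + 1)) : Prop where
  tangent : lor (f x) ν = 0
  unit : lor ν ν = 1
  normal : ∀ i, lor (partialD f x i) ν = 0

/-- The second fundamental form `hᵢⱼ = -⟨∇ᵢ ∂ⱼ f, ν⟩` with respect to a unit normal `ν`, where `∇` is
the Levi-Civita connection of `ℍ^{m+1}`. This connection is the tangential part of the flat
derivative, the remainder being a multiple of `f x`, which is orthogonal to `ν`; hence
`⟨∇ᵢ ∂ⱼ f, ν⟩ = ⟨∂ᵢ ∂ⱼ f, ν⟩`. The sign makes spheres with outer normal have positive curvature. -/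
def secondFF (f : N → Minkowski (m + 1)) (x : N) (ν : Minkowski (m + 1)) :
    Matrix (Fin m) (Fin m) ℝ :=
  Matrix.of fun i j => -lor (partialDD f x i j) ν

/-- The mean curvature with respect to `ν`, `H = (κ₁ + ⋯ + κₘ) / m`: the average of the principal
curvatures, which are the eigenvalues of `g⁻¹ h`. -/
def meanCurvature (f : N → Minkowski (m + 1)) (x : N) (ν : Minkowski (m + 1)) : ℝ :=
  ((firstFF f x)⁻¹ * secondFF f x ν).trace / m

/-- `F : N × [0, T) → ℍ^{m+1}` is a smooth mean curvature flow of immersed hypersurfaces: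
`∂ₜ F = -H ν`. The vector `H ν` does not depend on which of the two unit normals is taken. The values
of `F` at times outside `[0, T)` play no role. -/
structure IsMCF (T : ℝ) (F : N → ℝ → Minkowski (m + 1)) : Prop where
  mem : ∀ x, ∀ t ∈ Set.Ico 0 T, F x t ∈ hyperbolicSpace (m + 1)
  smooth : ContMDiffOn ((𝓡 m).prod 𝓘(ℝ, ℝ)) 𝓘(ℝ, Minkowski (m + 1)) ∞
    (fun p : N × ℝ => F p.1 p.2) (Set.univ ×ˢ Set.Ico 0 T)
  immersion : ∀ x, ∀ t ∈ Set.Ico 0 T, Function.Injective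
    (mfderiv (𝓡 m) 𝓘(ℝ, Minkowski (m + 1)) (fun y => F y t) x)
  flow : ∀ x, ∀ t ∈ Set.Ico 0 T, ∃ ν, IsUnitNormal (fun y => F y t) x ν ∧
    HasDerivWithinAt (fun s => F x s) (-(meanCurvature (fun y => F y t) x ν • ν)) (Set.Ico 0 T) t

/-- The flow is proper in space-time: `(x, t) ↦ (F(x, t), t)` is a proper map on `N × [0, T)`.
Equivalently, the time slices are properly immersed and the mean curvature is bounded on the
part of the flow in `K × [0, T']` for every compact `K` and every `T' < T`. It holds for every flow
of a compact `N`. -/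
def IsProperFlow (T : ℝ) (F : N → ℝ → Minkowski (m + 1)) : Prop :=
  IsProperMap fun p : N × Set.Ico (0 : ℝ) T => (F p.1 p.2, p.2)

/-- The time slice `Σₜ = F(N, t)`. -/
def slice (F : N → ℝ → Minkowski (m + 1)) (t : ℝ) : Set (Minkowski (m + 1)) :=
  Set.range fun x => F x t

/-- The distance `d(t)` between the time slices of two flows. -/
def flowDist {N' : Type*} (F₁ : N → ℝ → Minkowski (m + 1)) (F₂ : N' → ℝ → Minkowski (m + 1))
    (t : ℝ) : ℝ :=
  setDist (slice F₁ t) (slice F₂ t)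

end Hypersurface

end HypMCF

end

/-!
Put `u(x, y, t) = -⟨F₁(x, t), F₂(y, t)⟩ - 1 = cosh d - 1 = 2 sinh² (d / 2)`. At a pair `p ≠ q` of
closest points both tangent spaces are the orthogonal complement of `{p, q}`, so `q` is a
combination of `p` and the normal at `p`, and vice versa. Moving both points simultaneously along a
common orthonormal basis of this tangent space and summing the second variations of `u` gives
`∂ₜ u ≥ -2 u` there. Although the second flow is not compact, properness makes the space-time
sublevel sets of `u` compact, so `exp(2t) min u` does not fall below its initial value by the
maximum principle.
-/

namespace HypMCF

open Filter Topology

section BilinearForms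

lemma linearIndependent_pair_of_gram {K V : Type*} [Field K] [AddCommGroup V] [Module K V]
    {B : LinearMap.BilinForm K V} (hB : B.IsSymm) {u v : V} (h : B u u * B v v ≠ B u v ^ 2) :
    LinearIndependent K ![u, v] := by
  refine LinearIndependent.pair_iff.2 fun s t hst => ?_
  have hu : s * B u u + t * B u v = 0 := by simpa using congrArg (B u) hst
  have hv : s * B u v + t * B v v = 0 := by simpa [hB.eq v u] using congrArg (B v) hst
  have hdet : B u u * B v v - B u v ^ 2 ≠ 0 := sub_ne_zero.2 h
  constructor
  · refine (mul_eq_zero.1 ?_).resolve_right hdet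
    linear_combination B v v * hu - B u v * hv
  · refine (mul_eq_zero.1 ?_).resolve_right hdet
    linear_combination B u u * hv - B u v * hu

lemma range_eq_orthogonal {K V E : Type*} [Field K] [AddCommGroup V] [Module K V]
    [FiniteDimensional K V] [AddCommGroup E] [Module K E] {B : LinearMap.BilinForm K V}
    (hB : B.Nondegenerate) {W : Submodule K V} {A : E →ₗ[K] V} (hA : Function.Injective A)
    (hdim : Module.finrank K W + Module.finrank K E = Module.finrank K V)
    (horth : ∀ w ∈ W, ∀ a, B w (A a) = 0) : A.range = B.orthogonal W := by
  refine Submodule.eq_of_le_of_finrank_le ?_ ?_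
  · rintro _ ⟨a, rfl⟩ w hw
    exact horth w hw a
  · rw [LinearMap.BilinForm.finrank_orthogonal hB, LinearMap.finrank_range_of_inj hA]
    lia

lemma exists_linearEquiv_of_range_eq {K V E₁ E₂ : Type*} [Ring K] [AddCommGroup V] [Module K V]
    [AddCommGroup E₁] [Module K E₁] [AddCommGroup E₂] [Module K E₂] {A₁ : E₁ →ₗ[K] V}
    {A₂ : E₂ →ₗ[K] V} (h₁ : Function.Injective A₁) (h₂ : Function.Injective A₂)
    (h : A₁.range = A₂.range) : ∃ L : E₁ ≃ₗ[K] E₂, ∀ a, A₂ (L a) = A₁ a := by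
  let L := (LinearEquiv.ofInjective A₁ h₁).trans (LinearEquiv.ofEq _ _ h)
  refine ⟨L.trans (LinearEquiv.ofInjective A₂ h₂).symm, fun a => ?_⟩
  exact congrArg Subtype.val ((LinearEquiv.ofInjective A₂ h₂).apply_symm_apply (L a))

lemma exists_basis_toMatrix_eq_one {ι V : Type*} [Fintype ι] [DecidableEq ι] [AddCommGroup V]
    [Module ℝ V] (e : Module.Basis ι ℝ V) {G : LinearMap.BilinForm ℝ V} (hsymm : G.IsSymm)
    (hpos : ∀ v, v ≠ 0 → 0 < G v v) :
    ∃ a : Module.Basis ι ℝ V, LinearMap.BilinForm.toMatrix a G = 1 := by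
  have : FiniteDimensional ℝ V := e.finiteDimensional_of_finite
  obtain ⟨v, hv⟩ := LinearMap.BilinForm.exists_orthogonal_basis ⟨hsymm.eq⟩
  let w := v.reindex (Fintype.equivFinOfCardEq (Module.finrank_eq_card_basis e).symm).symm
  have hw : ∀ k l, k ≠ l → G (w k) (w l) = 0 := fun k l hkl => by
    simpa [w] using hv ((Equiv.injective _).ne hkl)
  have hsqrt : ∀ k, 0 < √(G (w k) (w k)) := fun k => Real.sqrt_pos.2 (hpos _ (w.ne_zero k))
  refine ⟨w.isUnitSMul fun k => (inv_pos.2 (hsqrt k)).ne'.isUnit, ?_⟩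
  ext k l
  rw [LinearMap.BilinForm.toMatrix_apply, Module.Basis.isUnitSMul_apply,
    Module.Basis.isUnitSMul_apply, map_smul, map_smul, LinearMap.smul_apply, smul_eq_mul,
    smul_eq_mul]
  rcases eq_or_ne k l with rfl | hkl
  · rw [Matrix.one_apply_eq]
    have := (hsqrt k).ne'
    field_simp
    exact (Real.sq_sqrt (hpos _ (w.ne_zero k)).le).symm
  · rw [hw k l hkl, Matrix.one_apply_ne hkl, mul_zero, mul_zero]

lemma trace_inv_toMatrix_mul_toMatrix {ι R V : Type*} [Fintype ι] [DecidableEq ι] [CommRing R]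
    [AddCommGroup V] [Module R V] (e : Module.Basis ι R V) {a : Module.Basis ι R V}
    {G : LinearMap.BilinForm R V} (ha : LinearMap.BilinForm.toMatrix a G = 1)
    (B : LinearMap.BilinForm R V) :
    ((LinearMap.BilinForm.toMatrix e G)⁻¹ * LinearMap.BilinForm.toMatrix e B).trace =
      ∑ k, B (a k) (a k) := by
  set P := e.toMatrix a
  have hconj (C : LinearMap.BilinForm R V) :
      P.transpose * LinearMap.BilinForm.toMatrix e C * P = LinearMap.BilinForm.toMatrix a C :=
    LinearMap.BilinForm.toMatrix_mul_basis_toMatrix e a C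
  have hinv : (LinearMap.BilinForm.toMatrix e G)⁻¹ = P * P.transpose := by
    refine Matrix.inv_eq_left_inv ?_
    rw [mul_assoc, mul_eq_one_comm, hconj, ha]
  rw [hinv, mul_assoc, Matrix.trace_mul_comm, hconj]
  simp only [Matrix.trace, Matrix.diag_apply, LinearMap.BilinForm.toMatrix_apply]

end BilinearForms

section Lorentz

variable {n : ℕ}

/-- The Lorentzian inner product as a continuous bilinear form, which makes the calculus of bounded
bilinear maps available. -/
noncomputable def lorCLM (n : ℕ) : Minkowski n →L[ℝ] Minkowski n →L[ℝ] ℝ :=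
  (innerSL ℝ).bilinearComp (.snd ℝ ℝ (EuclideanSpace ℝ (Fin n))) (.snd ℝ ℝ _) -
    (ContinuousLinearMap.mul ℝ ℝ).bilinearComp (.fst ℝ ℝ _) (.fst ℝ ℝ _)

/-- The Lorentzian inner product as an algebraic bilinear form. -/
noncomputable def lorForm (n : ℕ) : LinearMap.BilinForm ℝ (Minkowski n) := (lorCLM n).toBilinForm

lemma lorForm_apply (x y : Minkowski n) : lorForm n x y = lor x y := rfl

lemma lor_comm (x y : Minkowski n) : lor x y = lor y x := by
  rw [lor, lor, real_inner_comm, mul_comm]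

lemma lor_add_right (x y z : Minkowski n) : lor x (y + z) = lor x y + lor x z :=
  (lorForm n x).map_add y z

lemma lor_smul_right (c : ℝ) (x y : Minkowski n) : lor x (c • y) = c * lor x y :=
  (lorForm n x).map_smul c y

lemma lor_neg_right (x y : Minkowski n) : lor x (-y) = -lor x y := (lorForm n x).map_neg y

lemma continuous_lor : Continuous fun p : Minkowski n × Minkowski n => lor p.1 p.2 :=
  (lorCLM n).continuous₂

lemma isSymm_lorForm : (lorForm n).IsSymm := ⟨lor_comm⟩

lemma nondegenerate_lorForm : (lorForm n).Nondegenerate := by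
  refine (LinearMap.BilinForm.IsSymm.isRefl isSymm_lorForm).nondegenerate_iff_separatingLeft.2
    fun x hx => ?_
  have h : ‖x.2‖ ^ 2 + x.1 ^ 2 = 0 := by
    have h := hx (-x.1, x.2)
    rw [lorForm_apply, lor, real_inner_self_eq_norm_sq] at h
    linarith
  have h₁ : x.1 = 0 := by nlinarith [sq_nonneg ‖x.2‖, sq_nonneg x.1]
  have h₂ : ‖x.2‖ = 0 := by nlinarith [sq_nonneg ‖x.2‖, sq_nonneg x.1]
  exact Prod.ext h₁ (norm_eq_zero.1 h₂)

lemma range_eq_orthogonal_span_pair {E : Type*} [AddCommGroup E] [Module ℝ E]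
    (hE : Module.finrank ℝ E + 1 = n) {A : E →ₗ[ℝ] Minkowski n} (hA : Function.Injective A)
    {u v : Minkowski n} (huv : lor u u * lor v v ≠ lor u v ^ 2) (hu : ∀ a, lor u (A a) = 0)
    (hv : ∀ a, lor v (A a) = 0) : A.range = (lorForm n).orthogonal (Submodule.span ℝ {u, v}) := by
  have hli := linearIndependent_pair_of_gram isSymm_lorForm (u := u) (v := v) huv
  have hspan : Module.finrank ℝ (Submodule.span ℝ {u, v}) = 2 := by
    rw [← Matrix.range_cons_cons_empty u v ![], finrank_span_eq_card hli, Fintype.card_fin]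
  refine range_eq_orthogonal nondegenerate_lorForm hA ?_ fun w hw a => ?_
  · rw [hspan, Module.finrank_prod, Module.finrank_self, finrank_euclideanSpace_fin]
    lia
  · obtain ⟨s, t, rfl⟩ := Submodule.mem_span_pair.1 hw
    simp only [map_add, map_smul, LinearMap.add_apply, LinearMap.smul_apply, lorForm_apply, hu, hv,
      smul_zero, add_zero]

lemma eq_smul_normal_sub_smul {E : Type*} [AddCommGroup E] [Module ℝ E]
    (hE : Module.finrank ℝ E + 1 = n) {A : E →ₗ[ℝ] Minkowski n} (hA : Function.Injective A)
    {p q ν : Minkowski n} (hp : lor p p = -1) (hν : lor ν ν = 1) (hpν : lor p ν = 0)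
    (hAp : ∀ a, lor p (A a) = 0) (hAν : ∀ a, lor ν (A a) = 0) (hAq : ∀ a, lor q (A a) = 0) :
    q = lor q ν • ν - lor p q • p := by
  have hrange := range_eq_orthogonal_span_pair hE hA (u := p) (v := ν)
    (by rw [hp, hν, hpν]; norm_num) hAp hAν
  have hq : q ∈ Submodule.span ℝ {p, ν} := by
    rw [← LinearMap.BilinForm.orthogonal_orthogonal nondegenerate_lorForm
      (LinearMap.BilinForm.IsSymm.isRefl isSymm_lorForm) (Submodule.span ℝ {p, ν}), ← hrange]
    rintro _ ⟨a, rfl⟩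
    exact (lor_comm _ _).trans (hAq a)
  obtain ⟨s, t, rfl⟩ := Submodule.mem_span_pair.1 hq
  have ht : lor (s • p + t • ν) ν = t := by
    rw [lor_comm, lor_add_right, lor_smul_right, lor_smul_right, lor_comm ν p, hpν, hν]; ring
  have hs : lor p (s • p + t • ν) = -s := by
    rw [lor_add_right, lor_smul_right, lor_smul_right, hp, hpν]; ring
  rw [ht, hs]
  module

end Lorentz

section HyperbolicSpace

variable {n : ℕ} {p q : Minkowski n}

lemma norm_snd_sq_of_mem (hp : p ∈ hyperbolicSpace n) : ‖p.2‖ ^ 2 = p.1 ^ 2 - 1 := by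
  have h := hp.1
  rw [lor, real_inner_self_eq_norm_sq] at h
  linarith

lemma norm_snd_lt_fst_of_mem (hp : p ∈ hyperbolicSpace n) : ‖p.2‖ < p.1 :=
  lt_of_pow_lt_pow_left₀ 2 hp.2.le (by linarith [norm_snd_sq_of_mem hp])

lemma norm_le_fst_of_mem (hp : p ∈ hyperbolicSpace n) : ‖p‖ ≤ p.1 := by
  rw [Prod.norm_def, Real.norm_eq_abs, abs_of_pos hp.2]
  exact max_le le_rfl (norm_snd_lt_fst_of_mem hp).le

lemma lor_self_pos_of_tangent {v : Minkowski n} (hp : p ∈ hyperbolicSpace n) (hv : lor p v = 0)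
    (hv₀ : v ≠ 0) : 0 < lor v v := by
  have hinner : p.1 * v.1 = inner ℝ p.2 v.2 := (sub_eq_zero.1 hv).symm
  have hv₂ : v.2 ≠ 0 := fun h => by
    rw [h, inner_zero_right] at hinner
    exact hv₀ (Prod.ext ((mul_eq_zero.1 hinner).resolve_left hp.2.ne') h)
  have hlt : (p.1 * v.1) ^ 2 < (p.1 * ‖v.2‖) ^ 2 := by
    refine sq_lt_sq.2 ?_
    calc |p.1 * v.1| ≤ ‖p.2‖ * ‖v.2‖ := hinner ▸ abs_real_inner_le_norm _ _
      _ < p.1 * ‖v.2‖ := by gcongr; exact norm_snd_lt_fst_of_mem hp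
      _ ≤ |p.1 * ‖v.2‖| := le_abs_self _
  rw [mul_pow, mul_pow] at hlt
  rw [lor, real_inner_self_eq_norm_sq, ← sq]
  exact sub_pos.2 (lt_of_mul_lt_mul_left hlt (sq_nonneg _))

lemma one_le_neg_lor (hp : p ∈ hyperbolicSpace n) (hq : q ∈ hyperbolicSpace n) :
    1 ≤ -lor p q := by
  have hsq : (1 + ‖p.2‖ * ‖q.2‖) ^ 2 ≤ (p.1 * q.1) ^ 2 := by
    have hp₁ : p.1 ^ 2 = 1 + ‖p.2‖ ^ 2 := by linarith [norm_snd_sq_of_mem hp]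
    have hq₁ : q.1 ^ 2 = 1 + ‖q.2‖ ^ 2 := by linarith [norm_snd_sq_of_mem hq]
    rw [mul_pow, hp₁, hq₁]
    linarith [sq_nonneg (‖p.2‖ - ‖q.2‖)]
  have hle := le_of_sq_le_sq hsq (mul_pos hp.2 hq.2).le
  rw [lor]
  linarith [real_inner_le_norm p.2 q.2]

lemma fst_le_two_mul_fst_mul_neg_lor (hp : p ∈ hyperbolicSpace n) (hq : q ∈ hyperbolicSpace n) :
    q.1 ≤ 2 * p.1 * -lor p q := by
  have hlor : q.1 * (p.1 - ‖p.2‖) ≤ -lor p q := by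
    rw [lor]
    nlinarith [real_inner_le_norm p.2 q.2, norm_nonneg p.2, norm_snd_lt_fst_of_mem hq]
  calc q.1 = (p.1 + ‖p.2‖) * (q.1 * (p.1 - ‖p.2‖)) := by
        linear_combination q.1 * norm_snd_sq_of_mem hp
    _ ≤ 2 * p.1 * (q.1 * (p.1 - ‖p.2‖)) := by
        have hlt := norm_snd_lt_fst_of_mem hp
        exact mul_le_mul_of_nonneg_right (by linarith) (mul_nonneg hq.2.le (by linarith))
    _ ≤ 2 * p.1 * -lor p q := mul_le_mul_of_nonneg_left hlor (by linarith [hp.2])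

lemma hdist_nonneg (hp : p ∈ hyperbolicSpace n) (hq : q ∈ hyperbolicSpace n) : 0 ≤ hdist p q :=
  Real.arcosh_nonneg (one_le_neg_lor hp hq)

lemma two_mul_sinh_half_hdist_sq (hp : p ∈ hyperbolicSpace n) (hq : q ∈ hyperbolicSpace n) :
    2 * Real.sinh (hdist p q / 2) ^ 2 = -lor p q - 1 := by
  have hcosh : Real.cosh (2 * (hdist p q / 2)) = -lor p q := by
    rw [mul_div_cancel₀ _ two_ne_zero, hdist, Real.cosh_arcosh (one_le_neg_lor hp hq)]
  rw [Real.cosh_two_mul, Real.cosh_sq] at hcosh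
  linarith

end HyperbolicSpace

section Calculus

lemma deriv_deriv_nonpos_of_isLocalMax {f : ℝ → ℝ} {x : ℝ} (hmax : IsLocalMax f x)
    (hf : ContinuousAt f x) : deriv (deriv f) x ≤ 0 := by
  by_contra! hpos
  have hmin : IsLocalMin f x := isLocalMin_of_deriv_deriv_pos hpos hmax.deriv_eq_zero hf
  have hconst : f =ᶠ[𝓝 x] fun _ => f x := by
    filter_upwards [hmin, hmax] with s hge hle using le_antisymm hle hge
  have hzero : deriv (deriv f) x = 0 := by
    simpa only [deriv_const', deriv_const] using hconst.deriv.deriv_eq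
  exact hpos.ne' hzero

variable {E V W G : Type*} [NormedAddCommGroup E] [NormedSpace ℝ E] [NormedAddCommGroup V]
  [NormedSpace ℝ V] [NormedAddCommGroup W] [NormedSpace ℝ W] [NormedAddCommGroup G]
  [NormedSpace ℝ G]

lemma deriv_deriv_comp_add_smul {f : E → V} {u : E} (hf : ContDiffAt ℝ 2 f u) (a : E) :
    deriv (deriv fun s : ℝ => f (u + s • a)) 0 = fderiv ℝ (fderiv ℝ f) u a a := by
  have hline : Tendsto (fun s : ℝ => u + s • a) (𝓝 0) (𝓝 u) := by
    simpa only [zero_smul, add_zero] using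
      (show Continuous fun s : ℝ => u + s • a by fun_prop).tendsto 0
  have hderiv : deriv (fun s : ℝ => f (u + s • a)) =ᶠ[𝓝 0] fun s => fderiv ℝ f (u + s • a) a := by
    filter_upwards [hline.eventually (hf.eventually (by simp))] with s hs
    exact (hs.differentiableAt two_ne_zero).deriv_comp_add_smul
  have hdiff : DifferentiableAt ℝ (fderiv ℝ f) (u + (0 : ℝ) • a) := by
    rw [zero_smul, add_zero]
    exact (hf.fderiv_right (m := 1) (by norm_num)).differentiableAt one_ne_zero
  have hconst := differentiableAt_const (𝕜 := ℝ) (x := u + (0 : ℝ) • a) a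
  calc deriv (deriv fun s : ℝ => f (u + s • a)) 0
      = fderiv ℝ (fun v => fderiv ℝ f v a) (u + (0 : ℝ) • a) a :=
        hderiv.deriv_eq.trans (hdiff.clm_apply hconst).deriv_comp_add_smul
    _ = fderiv ℝ (fderiv ℝ f) u a a := by
        rw [fderiv_clm_apply hdiff hconst, zero_smul, add_zero]
        simp

lemma deriv_deriv_bilinear (B : V →L[ℝ] W →L[ℝ] G) {c₁ : ℝ → V} {c₂ : ℝ → W} {t : ℝ}
    (h₁ : ContDiffAt ℝ 2 c₁ t) (h₂ : ContDiffAt ℝ 2 c₂ t) :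
    deriv (deriv fun s => B (c₁ s) (c₂ s)) t = B (deriv (deriv c₁) t) (c₂ t) +
      (2 : ℝ) • B (deriv c₁ t) (deriv c₂ t) + B (c₁ t) (deriv (deriv c₂) t) := by
  have hderiv {c₁ : ℝ → V} {c₂ : ℝ → W} {s : ℝ} (hc₁ : DifferentiableAt ℝ c₁ s)
      (hc₂ : DifferentiableAt ℝ c₂ s) :
      HasDerivAt (fun r => B (c₁ r) (c₂ r)) (B (c₁ s) (deriv c₂ s) + B (deriv c₁ s) (c₂ s)) s :=
    B.hasDerivAt_of_bilinear (fun _ => hc₁.hasDerivAt) fun _ => hc₂.hasDerivAt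
  have hev : (deriv fun s => B (c₁ s) (c₂ s)) =ᶠ[𝓝 t]
      fun s => B (c₁ s) (deriv c₂ s) + B (deriv c₁ s) (c₂ s) := by
    filter_upwards [h₁.eventually (by simp), h₂.eventually (by simp)] with s hs₁ hs₂
    exact (hderiv (hs₁.differentiableAt two_ne_zero) (hs₂.differentiableAt two_ne_zero)).deriv
  have hd₁ := h₁.differentiableAt two_ne_zero
  have hd₂ := h₂.differentiableAt two_ne_zero
  have hdd₁ := (h₁.derivWithin (m := 1) (by norm_num)).differentiableAt one_ne_zero
  have hdd₂ := (h₂.derivWithin (m := 1) (by norm_num)).differentiableAt one_ne_zero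
  rw [hev.deriv_eq, ((hderiv hd₁ hdd₂).fun_add (hderiv hdd₁ hd₂)).deriv, two_smul]
  abel

lemma hasDerivWithinAt_lor {n : ℕ} {c₁ c₂ : ℝ → Minkowski n} {v₁ v₂ : Minkowski n} {s : Set ℝ}
    {t : ℝ} (h₁ : HasDerivWithinAt c₁ v₁ s t) (h₂ : HasDerivWithinAt c₂ v₂ s t) :
    HasDerivWithinAt (fun r => lor (c₁ r) (c₂ r)) (lor (c₁ t) v₂ + lor v₁ (c₂ t)) s t :=
  (lorCLM n).hasDerivWithinAt_of_bilinear h₁ h₂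

lemma deriv_lor {n : ℕ} {c₁ c₂ : ℝ → Minkowski n} {t : ℝ} (h₁ : DifferentiableAt ℝ c₁ t)
    (h₂ : DifferentiableAt ℝ c₂ t) :
    deriv (fun s => lor (c₁ s) (c₂ s)) t = lor (c₁ t) (deriv c₂ t) + lor (deriv c₁ t) (c₂ t) :=
  (lorCLM n).deriv_of_bilinear (fun _ => h₁) fun _ => h₂

lemma deriv_deriv_lor {n : ℕ} {c₁ c₂ : ℝ → Minkowski n} {t : ℝ} (h₁ : ContDiffAt ℝ 2 c₁ t)
    (h₂ : ContDiffAt ℝ 2 c₂ t) :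
    deriv (deriv fun s => lor (c₁ s) (c₂ s)) t = lor (deriv (deriv c₁) t) (c₂ t) +
      2 * lor (deriv c₁ t) (deriv c₂ t) + lor (c₁ t) (deriv (deriv c₂) t) :=
  deriv_deriv_bilinear (lorCLM n) h₁ h₂

lemma mul_sinh_le_sinh_mul {k r : ℝ} (hk : 1 ≤ k) (hr : 0 ≤ r) :
    k * Real.sinh r ≤ Real.sinh (k * r) := by
  have hderiv (s : ℝ) : HasDerivAt (fun s => Real.sinh (k * s) - k * Real.sinh s)
      (Real.cosh (k * s) * (k * 1) - k * Real.cosh s) s :=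
    ((hasDerivAt_id' s).const_mul k).sinh.fun_sub ((Real.hasDerivAt_sinh s).const_mul k)
  have hmono : MonotoneOn (fun s => Real.sinh (k * s) - k * Real.sinh s) (Set.Ici 0) := by
    refine monotoneOn_of_deriv_nonneg (convex_Ici 0) (by fun_prop)
      (fun s _ => (hderiv s).differentiableAt.differentiableWithinAt) fun s hs => ?_
    rw [interior_Ici] at hs
    have hcosh : Real.cosh s ≤ Real.cosh (k * s) := by
      rw [Real.cosh_le_cosh, abs_of_pos hs, abs_of_pos (mul_pos (by linarith) hs)]
      exact le_mul_of_one_le_left hs.le hk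
    rw [(hderiv s).deriv]
    nlinarith
  have h := hmono Set.self_mem_Ici hr hr
  simp only [mul_zero, Real.sinh_zero, sub_zero] at h
  linarith

end Calculus

section Hypersurface

variable {m : ℕ} {N : Type*} [TopologicalSpace N] [ChartedSpace (EuclideanSpace ℝ (Fin m)) N]
  {f : N → Minkowski (m + 1)} {x : N}

/-- The differential of `f` at `x`, read in the preferred chart of `N` around `x`. -/
noncomputable def differential (f : N → Minkowski (m + 1)) (x : N) :
    EuclideanSpace ℝ (Fin m) →L[ℝ] Minkowski (m + 1) :=
  fderiv ℝ (localRep f x) (extChartAt (𝓡 m) x x)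

/-- The second derivative of `f` at `x`, as a flat Hessian in the preferred chart of `N` around
`x`. -/
noncomputable def hessian (f : N → Minkowski (m + 1)) (x : N) :
    EuclideanSpace ℝ (Fin m) →L[ℝ] EuclideanSpace ℝ (Fin m) →L[ℝ] Minkowski (m + 1) :=
  fderiv ℝ (fderiv ℝ (localRep f x)) (extChartAt (𝓡 m) x x)

/-- The image under `f` of the straight line through `x` in direction `a` in the preferred chart of
`N` around `x`. Outside the chart target it takes junk values, which however still lie in the range
of `f`. -/
noncomputable def coordLine (f : N → Minkowski (m + 1)) (x : N) (a : EuclideanSpace ℝ (Fin m))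
    (s : ℝ) : Minkowski (m + 1) :=
  localRep f x (extChartAt (𝓡 m) x x + s • a)

lemma coordLine_zero (f : N → Minkowski (m + 1)) (x : N) (a : EuclideanSpace ℝ (Fin m)) :
    coordLine f x a 0 = f x := by
  rw [coordLine, zero_smul, add_zero, localRep, Function.comp_apply, extChartAt_to_inv]

lemma contDiffAt_localRep {k : ℕ∞ω} (hf : ContMDiffAt (𝓡 m) 𝓘(ℝ, Minkowski (m + 1)) k f x) :
    ContDiffAt ℝ k (localRep f x) (extChartAt (𝓡 m) x x) := by
  have h := (contMDiffAt_iff.1 hf).2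
  rwa [ModelWithCorners.range_eq_univ, contDiffWithinAt_univ] at h

lemma contDiffAt_coordLine {k : ℕ∞ω} (hf : ContMDiffAt (𝓡 m) 𝓘(ℝ, Minkowski (m + 1)) k f x)
    (a : EuclideanSpace ℝ (Fin m)) : ContDiffAt ℝ k (coordLine f x a) 0 := by
  refine ContDiffAt.comp (g := localRep f x) 0 ?_ (by fun_prop)
  rw [zero_smul, add_zero]
  exact contDiffAt_localRep hf

lemma mfderiv_eq_differential
    (hf : MDifferentiableAt (𝓡 m) 𝓘(ℝ, Minkowski (m + 1)) f x) :
    (mfderiv (𝓡 m) 𝓘(ℝ, Minkowski (m + 1)) f x :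
      EuclideanSpace ℝ (Fin m) →L[ℝ] Minkowski (m + 1)) = differential f x := by
  rw [hf.mfderiv, ModelWithCorners.range_eq_univ, fderivWithin_univ]
  rfl

lemma deriv_coordLine (hf : ContMDiffAt (𝓡 m) 𝓘(ℝ, Minkowski (m + 1)) 1 f x)
    (a : EuclideanSpace ℝ (Fin m)) : deriv (coordLine f x a) 0 = differential f x a := by
  have hd := (contDiffAt_localRep hf).differentiableAt one_ne_zero
  rw [differential, ← hd.lineDeriv_eq_fderiv]
  rfl

lemma deriv_deriv_coordLine (hf : ContMDiffAt (𝓡 m) 𝓘(ℝ, Minkowski (m + 1)) 2 f x)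
    (a : EuclideanSpace ℝ (Fin m)) : deriv (deriv (coordLine f x a)) 0 = hessian f x a a :=
  deriv_deriv_comp_add_smul (contDiffAt_localRep hf) a

lemma lor_coordLine_self (hmem : ∀ z, f z ∈ hyperbolicSpace (m + 1))
    (a : EuclideanSpace ℝ (Fin m)) :
    (fun s => lor (coordLine f x a s) (coordLine f x a s)) = fun _ => -1 :=
  funext fun _ => (hmem _).1

lemma lor_differential (hf : ContMDiffAt (𝓡 m) 𝓘(ℝ, Minkowski (m + 1)) 1 f x)
    (hmem : ∀ z, f z ∈ hyperbolicSpace (m + 1)) (a : EuclideanSpace ℝ (Fin m)) :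
    lor (f x) (differential f x a) = 0 := by
  have hd := (contDiffAt_coordLine hf a).differentiableAt one_ne_zero
  have h := deriv_lor hd hd
  rw [lor_coordLine_self hmem, deriv_const, coordLine_zero, deriv_coordLine hf,
    lor_comm (differential f x a)] at h
  linarith

lemma lor_hessian_self (hf : ContMDiffAt (𝓡 m) 𝓘(ℝ, Minkowski (m + 1)) 2 f x)
    (hmem : ∀ z, f z ∈ hyperbolicSpace (m + 1)) (a : EuclideanSpace ℝ (Fin m)) :
    lor (f x) (hessian f x a a) = -lor (differential f x a) (differential f x a) := by
  have hd := contDiffAt_coordLine hf a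
  have h := deriv_deriv_lor hd hd
  rw [lor_coordLine_self hmem, deriv_const', deriv_const, coordLine_zero,
    deriv_coordLine (hf.of_le one_le_two), deriv_deriv_coordLine hf,
    lor_comm (hessian f x a a)] at h
  linarith

lemma IsUnitNormal.lor_differential {ν : Minkowski (m + 1)} (h : IsUnitNormal f x ν)
    (a : EuclideanSpace ℝ (Fin m)) : lor ν (differential f x a) = 0 := by
  have hzero : (lorForm (m + 1) ν).comp (differential f x).toLinearMap = 0 := by
    refine (EuclideanSpace.basisFun (Fin m) ℝ).toBasis.ext fun i => ?_
    rw [OrthonormalBasis.coe_toBasis, EuclideanSpace.basisFun_apply]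
    exact (lor_comm _ _).trans (h.normal i)
  exact LinearMap.congr_fun hzero a

/-- The induced metric (first fundamental form) as a bilinear form. -/
noncomputable def inducedMetric (f : N → Minkowski (m + 1)) (x : N) :
    LinearMap.BilinForm ℝ (EuclideanSpace ℝ (Fin m)) :=
  (lorForm (m + 1)).comp (differential f x).toLinearMap (differential f x).toLinearMap

/-- The second fundamental form with respect to the unit normal `ν` as a bilinear form. -/
noncomputable def secondForm (f : N → Minkowski (m + 1)) (x : N) (ν : Minkowski (m + 1)) :
    LinearMap.BilinForm ℝ (EuclideanSpace ℝ (Fin m)) :=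
  (hessian f x).toLinearMap₁₂.compr₂ (-lorForm (m + 1) ν)

lemma inducedMetric_apply (f : N → Minkowski (m + 1)) (x : N) (a b : EuclideanSpace ℝ (Fin m)) :
    inducedMetric f x a b = lor (differential f x a) (differential f x b) := rfl

lemma secondForm_apply (f : N → Minkowski (m + 1)) (x : N) (ν : Minkowski (m + 1))
    (a b : EuclideanSpace ℝ (Fin m)) : secondForm f x ν a b = -lor ν (hessian f x a b) := rfl

lemma meanCurvature_eq_sum (f : N → Minkowski (m + 1)) (x : N) (ν : Minkowski (m + 1))
    {a : Module.Basis (Fin m) ℝ (EuclideanSpace ℝ (Fin m))}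
    (ha : LinearMap.BilinForm.toMatrix a (inducedMetric f x) = 1) :
    meanCurvature f x ν = (∑ k, secondForm f x ν (a k) (a k)) / m := by
  let e := (EuclideanSpace.basisFun (Fin m) ℝ).toBasis
  have he (i : Fin m) : e i = EuclideanSpace.single i 1 := by
    rw [OrthonormalBasis.coe_toBasis, EuclideanSpace.basisFun_apply]
  have hfirst : firstFF f x = LinearMap.BilinForm.toMatrix e (inducedMetric f x) := by
    ext i j
    rw [LinearMap.BilinForm.toMatrix_apply, he, he]
    rfl
  have hsecond : secondFF f x ν = LinearMap.BilinForm.toMatrix e (secondForm f x ν) := by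
    ext i j
    rw [LinearMap.BilinForm.toMatrix_apply, he, he, secondForm_apply, lor_comm]
    rfl
  rw [meanCurvature, hfirst, hsecond, trace_inv_toMatrix_mul_toMatrix e ha]

/-- `f` maps `N` into `ℍ^{m+1}`, and near `x` it is a `C²` immersion with unit normal `ν` at `x`. -/
structure IsHypersurfaceAt (f : N → Minkowski (m + 1)) (x : N) (ν : Minkowski (m + 1)) : Prop where
  contMDiffAt : ContMDiffAt (𝓡 m) 𝓘(ℝ, Minkowski (m + 1)) 2 f x
  mem : ∀ z, f z ∈ hyperbolicSpace (m + 1)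
  injective : Function.Injective (differential f x)
  isUnitNormal : IsUnitNormal f x ν

namespace IsHypersurfaceAt

variable {ν : Minkowski (m + 1)}

lemma inducedMetric_pos (h : IsHypersurfaceAt f x ν) {a : EuclideanSpace ℝ (Fin m)} (ha : a ≠ 0) :
    0 < inducedMetric f x a a :=
  lor_self_pos_of_tangent (h.mem x) (lor_differential (h.contMDiffAt.of_le one_le_two) h.mem a)
    ((map_ne_zero_iff _ h.injective).2 ha)

lemma lor_hessian_of_orthogonal (h : IsHypersurfaceAt f x ν) {q : Minkowski (m + 1)}
    (hq : ∀ a, lor q (differential f x a) = 0) (a : EuclideanSpace ℝ (Fin m)) :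
    lor q (hessian f x a a) =
      lor (f x) q * inducedMetric f x a a - lor q ν * secondForm f x ν a a := by
  -- The orthogonal complement of the tangent space is spanned by `f x` and `ν`.
  have hspan : q = lor q ν • ν - lor (f x) q • f x :=
    eq_smul_normal_sub_smul (by rw [finrank_euclideanSpace_fin])
      (A := (differential f x).toLinearMap) h.injective (h.mem x).1 h.isUnitNormal.unit
      h.isUnitNormal.tangent (lor_differential (h.contMDiffAt.of_le one_le_two) h.mem)
      h.isUnitNormal.lor_differential hq
  have hlor := congrArg (fun v => lorForm (m + 1) v (hessian f x a a)) hspan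
  simp only [map_sub, map_smul, LinearMap.sub_apply, LinearMap.smul_apply, lorForm_apply,
    smul_eq_mul] at hlor
  rw [hlor, lor_hessian_self h.contMDiffAt h.mem, secondForm_apply, inducedMetric_apply]
  ring

end IsHypersurfaceAt

end Hypersurface

section ClosestPair

variable {m : ℕ} {N₁ N₂ : Type*} {f₁ : N₁ → Minkowski (m + 1)} {f₂ : N₂ → Minkowski (m + 1)}
  {x : N₁} {y : N₂} {ν₁ ν₂ : Minkowski (m + 1)}

/-- `f₁ x` and `f₂ y` realize the distance between the images of `f₁` and `f₂`: as
`cosh d(p, q) = -⟨p, q⟩`, minimizing the distance means maximizing the Lorentzian inner product. -/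
def IsClosestPair (f₁ : N₁ → Minkowski (m + 1)) (f₂ : N₂ → Minkowski (m + 1)) (x : N₁) (y : N₂) :
    Prop :=
  ∀ z w, lor (f₁ z) (f₂ w) ≤ lor (f₁ x) (f₂ y)

lemma IsClosestPair.symm (h : IsClosestPair f₁ f₂ x y) : IsClosestPair f₂ f₁ y x := fun w z => by
  rw [lor_comm, lor_comm (f₂ y)]
  exact h z w

variable [TopologicalSpace N₁] [ChartedSpace (EuclideanSpace ℝ (Fin m)) N₁]

lemma IsClosestPair.first_variation (h : IsClosestPair f₁ f₂ x y)
    (h₁ : ContMDiffAt (𝓡 m) 𝓘(ℝ, Minkowski (m + 1)) 1 f₁ x) (a : EuclideanSpace ℝ (Fin m)) :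
    lor (f₂ y) (differential f₁ x a) = 0 := by
  have hmax : IsLocalMax (fun s => lor (f₂ y) (coordLine f₁ x a s)) 0 :=
    Eventually.of_forall fun s => (h.symm y _).trans_eq (by simp only [coordLine_zero])
  have hd := (contDiffAt_coordLine h₁ a).differentiableAt one_ne_zero
  have hderiv := ((lorCLM _ (f₂ y)).hasFDerivAt.comp_hasDerivAt 0 hd.hasDerivAt)
  rw [deriv_coordLine h₁] at hderiv
  exact hmax.hasDerivAt_eq_zero hderiv

lemma IsClosestPair.range_differential (h : IsClosestPair f₁ f₂ x y)
    (hlt : 1 < -lor (f₁ x) (f₂ y)) (h₁ : IsHypersurfaceAt f₁ x ν₁) (hq : f₂ y ∈ hyperbolicSpace _) :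
    (differential f₁ x).toLinearMap.range =
      (lorForm (m + 1)).orthogonal (Submodule.span ℝ {f₁ x, f₂ y}) := by
  have hsmooth := h₁.contMDiffAt.of_le one_le_two
  refine range_eq_orthogonal_span_pair (by rw [finrank_euclideanSpace_fin]) h₁.injective ?_
    (lor_differential hsmooth h₁.mem) (h.first_variation hsmooth)
  rw [(h₁.mem x).1, hq.1]
  nlinarith

variable [TopologicalSpace N₂] [ChartedSpace (EuclideanSpace ℝ (Fin m)) N₂]

lemma IsClosestPair.second_variation (h : IsClosestPair f₁ f₂ x y)
    (h₁ : ContMDiffAt (𝓡 m) 𝓘(ℝ, Minkowski (m + 1)) 2 f₁ x)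
    (h₂ : ContMDiffAt (𝓡 m) 𝓘(ℝ, Minkowski (m + 1)) 2 f₂ y) (a b : EuclideanSpace ℝ (Fin m)) :
    lor (f₂ y) (hessian f₁ x a a) + 2 * lor (differential f₁ x a) (differential f₂ y b) +
      lor (f₁ x) (hessian f₂ y b b) ≤ 0 := by
  have hd₁ := contDiffAt_coordLine h₁ a
  have hd₂ := contDiffAt_coordLine h₂ b
  have hmax : IsLocalMax (fun s => lor (coordLine f₁ x a s) (coordLine f₂ y b s)) 0 :=
    Eventually.of_forall fun s => (h _ _).trans_eq (by simp only [coordLine_zero])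
  have hcont : ContinuousAt (fun s => lor (coordLine f₁ x a s) (coordLine f₂ y b s)) 0 :=
    continuous_lor.continuousAt.comp₂ hd₁.continuousAt hd₂.continuousAt
  have hnonpos := deriv_deriv_nonpos_of_isLocalMax hmax hcont
  rwa [deriv_deriv_lor hd₁ hd₂, coordLine_zero, coordLine_zero,
    deriv_coordLine (h₁.of_le one_le_two), deriv_coordLine (h₂.of_le one_le_two),
    deriv_deriv_coordLine h₁, deriv_deriv_coordLine h₂, lor_comm _ (f₂ y)] at hnonpos

lemma IsClosestPair.secondForm_comparison (h : IsClosestPair f₁ f₂ x y)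
    (h₁ : IsHypersurfaceAt f₁ x ν₁) (h₂ : IsHypersurfaceAt f₂ y ν₂)
    {a b : EuclideanSpace ℝ (Fin m)} (hab : differential f₂ y b = differential f₁ x a) :
    -2 * (-lor (f₁ x) (f₂ y) - 1) * inducedMetric f₁ x a a ≤
      lor (f₂ y) ν₁ * secondForm f₁ x ν₁ a a + lor (f₁ x) ν₂ * secondForm f₂ y ν₂ b b := by
  have hsecond := h.second_variation h₁.contMDiffAt h₂.contMDiffAt a b
  have hmetric : inducedMetric f₂ y b b = inducedMetric f₁ x a a := by
    rw [inducedMetric_apply, inducedMetric_apply, hab]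
  rw [h₁.lor_hessian_of_orthogonal (h.first_variation (h₁.contMDiffAt.of_le one_le_two)),
    h₂.lor_hessian_of_orthogonal (h.symm.first_variation (h₂.contMDiffAt.of_le one_le_two)),
    hab, ← inducedMetric_apply, hmetric, lor_comm (f₂ y) (f₁ x)] at hsecond
  linarith

lemma IsClosestPair.exists_common_orthonormal_basis (h : IsClosestPair f₁ f₂ x y)
    (hlt : 1 < -lor (f₁ x) (f₂ y)) (h₁ : IsHypersurfaceAt f₁ x ν₁)
    (h₂ : IsHypersurfaceAt f₂ y ν₂) :
    ∃ a b : Module.Basis (Fin m) ℝ (EuclideanSpace ℝ (Fin m)),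
      LinearMap.BilinForm.toMatrix a (inducedMetric f₁ x) = 1 ∧
      LinearMap.BilinForm.toMatrix b (inducedMetric f₂ y) = 1 ∧
      ∀ k, differential f₂ y (b k) = differential f₁ x (a k) := by
  have hrange : (differential f₁ x).toLinearMap.range = (differential f₂ y).toLinearMap.range := by
    rw [h.range_differential hlt h₁ (h₂.mem y),
      h.symm.range_differential (by rwa [lor_comm]) h₂ (h₁.mem x), Set.pair_comm]
  obtain ⟨L, hL⟩ := exists_linearEquiv_of_range_eq h₁.injective h₂.injective hrange
  obtain ⟨a, ha⟩ := exists_basis_toMatrix_eq_one (EuclideanSpace.basisFun (Fin m) ℝ).toBasis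
    (G := inducedMetric f₁ x) ⟨fun _ _ => lor_comm _ _⟩ fun _ hv => h₁.inducedMetric_pos hv
  have hab (k : Fin m) : differential f₂ y (a.map L k) = differential f₁ x (a k) := by
    rw [Module.Basis.map_apply]
    exact hL (a k)
  refine ⟨a, a.map L, ha, ?_, hab⟩
  rw [← ha]
  ext k l
  rw [LinearMap.BilinForm.toMatrix_apply, LinearMap.BilinForm.toMatrix_apply, inducedMetric_apply,
    inducedMetric_apply, hab, hab]

lemma IsClosestPair.meanCurvature_comparison (hm : m ≠ 0) (h : IsClosestPair f₁ f₂ x y)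
    (hlt : 1 < -lor (f₁ x) (f₂ y)) (h₁ : IsHypersurfaceAt f₁ x ν₁)
    (h₂ : IsHypersurfaceAt f₂ y ν₂) :
    -2 * (-lor (f₁ x) (f₂ y) - 1) ≤
      lor (f₂ y) ν₁ * meanCurvature f₁ x ν₁ + lor (f₁ x) ν₂ * meanCurvature f₂ y ν₂ := by
  obtain ⟨a, b, ha, hb, hab⟩ := h.exists_common_orthonormal_basis hlt h₁ h₂
  have hunit (k : Fin m) : inducedMetric f₁ x (a k) (a k) = 1 := by
    rw [← LinearMap.BilinForm.toMatrix_apply a, ha, Matrix.one_apply_eq]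
  have hsum := Finset.sum_le_sum fun k (_ : k ∈ Finset.univ) =>
    h.secondForm_comparison h₁ h₂ (hab k)
  simp only [hunit, mul_one, Finset.sum_const, Finset.card_univ, Fintype.card_fin, nsmul_eq_mul,
    Finset.sum_add_distrib, ← Finset.mul_sum] at hsum
  rw [meanCurvature_eq_sum f₁ x ν₁ ha, meanCurvature_eq_sum f₂ y ν₂ hb, mul_div_assoc',
    mul_div_assoc', ← add_div, le_div_iff₀' (by positivity)]
  exact hsum

end ClosestPair

section MaximumPrinciple

lemma nonpos_of_hasDerivWithinAt_of_le_left {f : ℝ → ℝ} {s v : ℝ} (hs : 0 < s)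
    (hf : HasDerivWithinAt f v (Set.Icc 0 s) s) (hmin : ∀ r ∈ Set.Icc 0 s, f s ≤ f r) : v ≤ 0 := by
  have hmem : 0 - s ∈ posTangentConeAt (Set.Icc 0 s) s :=
    sub_mem_posTangentConeAt_of_segment_subset (by rw [segment_symm, segment_eq_Icc hs.le])
  have hlocal : IsLocalMinOn f (Set.Icc 0 s) s := (isMinOn_iff.2 hmin).localize
  have h := hlocal.hasFDerivWithinAt_nonneg hf.hasFDerivWithinAt hmem
  rw [ContinuousLinearMap.toSpanSingleton_apply, smul_eq_mul] at h
  nlinarith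

variable {X : Type*} [TopologicalSpace X] {T c t : ℝ} {u : X → ℝ → ℝ}

lemma exists_first_minimum (hu : ∀ x, ContinuousOn (u x) (Set.Ico 0 T)) (ht : t ∈ Set.Ico 0 T)
    (hcompact : IsCompact {z : X × Set.Ico (0 : ℝ) T | (z.2 : ℝ) ≤ t ∧ u z.1 z.2 ≤ c})
    (hzero : ∀ x, c < u x 0) {x : X} (hx : u x t ≤ c) :
    ∃ s ∈ Set.Ioo 0 T, ∃ y, u y s = c ∧ (∀ z, c ≤ u z s) ∧ ∀ r ∈ Set.Icc 0 s, c ≤ u y r := by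
  obtain ⟨⟨y, s⟩, ⟨hst, hys⟩, hfirst⟩ := hcompact.exists_isMinOn
    ⟨(x, ⟨t, ht⟩), le_rfl, hx⟩ (continuous_subtype_val.comp continuous_snd).continuousOn
  have hbefore (z : X) (r : ℝ) (hr : r ∈ Set.Ico 0 (s : ℝ)) : c ≤ u z r := by
    by_contra! hlt
    exact hr.2.not_ge (hfirst (show (z, ⟨r, hr.1, hr.2.trans s.2.2⟩) ∈ _ from
      ⟨hr.2.le.trans hst, hlt.le⟩))
  have hpos : 0 < (s : ℝ) := by
    refine s.2.1.lt_of_ne fun h => (hzero y).not_ge ?_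
    rw [h]
    exact hys
  have hclosure (z : X) : ∀ r ∈ Set.Icc 0 (s : ℝ), c ≤ u z r := by
    rw [← closure_Ico hpos.ne]
    refine fun r hr => le_on_closure (hbefore z) continuousOn_const ((hu z).mono ?_) hr
    rw [closure_Ico hpos.ne]
    exact Set.Icc_subset_Ico_right s.2.2
  have hlast (z : X) : c ≤ u z s := hclosure z s (Set.right_mem_Icc.2 hpos.le)
  exact ⟨s, ⟨hpos, s.2.2⟩, y, hys.antisymm (hlast y), hlast, hclosure y⟩

lemma lt_of_deriv_pos_at_minima (hu : ∀ x, ContinuousOn (u x) (Set.Ico 0 T))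
    (ht : t ∈ Set.Ico 0 T)
    (hcompact : IsCompact {z : X × Set.Ico (0 : ℝ) T | (z.2 : ℝ) ≤ t ∧ u z.1 z.2 ≤ c})
    (hzero : ∀ x, c < u x 0)
    (hderiv : ∀ s ∈ Set.Ico 0 T, ∀ x, u x s = c → (∀ y, u x s ≤ u y s) →
      ∃ v, HasDerivWithinAt (u x) v (Set.Ico 0 T) s ∧ 0 < v) (x : X) : c < u x t := by
  by_contra! hx
  obtain ⟨s, hs, y, rfl, hmin, hleft⟩ := exists_first_minimum hu ht hcompact hzero hx
  obtain ⟨v, hv, hpos⟩ := hderiv s ⟨hs.1.le, hs.2⟩ y rfl hmin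
  exact hpos.not_ge (nonpos_of_hasDerivWithinAt_of_le_left hs.1
    (hv.mono (Set.Icc_subset_Ico_right hs.2)) hleft)

lemma lt_exp_mul_of_deriv_ge_at_minima
    (hu : Continuous fun z : X × Set.Ico (0 : ℝ) T => u z.1 z.2) (ht : t ∈ Set.Ico 0 T)
    (hcompact : IsCompact {z : X × Set.Ico (0 : ℝ) T | (z.2 : ℝ) ≤ t ∧ u z.1 z.2 ≤ c})
    (hc : 0 < c) (hzero : ∀ x, c ≤ u x 0) {k : ℝ} (hk : 0 ≤ k)
    (hderiv : ∀ s ∈ Set.Ico 0 T, ∀ x, 0 < u x s → (∀ y, u x s ≤ u y s) →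
      ∃ v, HasDerivWithinAt (u x) v (Set.Ico 0 T) s ∧ -k * u x s ≤ v) {ε : ℝ} (hε : 0 < ε) (x : X) :
    c < Real.exp (k * t + ε * (t + 1)) * u x t := by
  have hw : Continuous fun z : X × Set.Ico (0 : ℝ) T =>
      Real.exp (k * z.2 + ε * (z.2 + 1)) * u z.1 z.2 := .mul (by fun_prop) hu
  have htime : Continuous fun z : X × Set.Ico (0 : ℝ) T => (z.2 : ℝ) := by fun_prop
  -- Spatial minima of `u` are minima of `exp (k s + ε (s + 1)) u`, and the latter increases there.
  refine lt_of_deriv_pos_at_minima (u := fun x s => Real.exp (k * s + ε * (s + 1)) * u x s)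
    (fun y => ?_) ht (hcompact.of_isClosed_subset ?_ ?_) (fun y => ?_) (fun s hs y hy hmin => ?_) x
  · exact continuousOn_iff_continuous_domRestrict.2 (hw.comp (Continuous.prodMk_right y))
  · exact (isClosed_le htime continuous_const).inter (isClosed_le hw continuous_const)
  · rintro ⟨y, s⟩ ⟨hst, hy⟩
    refine ⟨hst, le_of_not_gt fun hlt => hy.not_gt (hlt.trans ?_)⟩
    have hs := s.2.1
    exact lt_mul_of_one_lt_left (hc.trans hlt) (Real.one_lt_exp_iff.2 (by positivity))
  · have hexp : 1 < Real.exp (k * 0 + ε * (0 + 1)) := Real.one_lt_exp_iff.2 (by linarith)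
    exact (hzero y).trans_lt (lt_mul_of_one_lt_left (hc.trans_le (hzero y)) hexp)
  · have hexp := Real.exp_pos (k * s + ε * (s + 1))
    have hpos : 0 < u y s := pos_of_mul_pos_right (hc.trans_eq hy.symm) hexp.le
    obtain ⟨v, hv, hge⟩ := hderiv s hs y hpos fun z => le_of_mul_le_mul_left (hmin z) hexp
    have hlin : HasDerivAt (fun r => k * r + ε * (r + 1)) (k * 1 + ε * 1) s :=
      ((hasDerivAt_id' s).const_mul k).fun_add (((hasDerivAt_id' s).add_const 1).const_mul ε)
    refine ⟨_, hlin.exp.hasDerivWithinAt.mul hv, ?_⟩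
    nlinarith [mul_pos hexp (mul_pos hε hpos), mul_le_mul_of_nonneg_left hge hexp.le]

theorem le_exp_mul_of_deriv_ge_at_minima
    (hu : Continuous fun z : X × Set.Ico (0 : ℝ) T => u z.1 z.2) (ht : t ∈ Set.Ico 0 T)
    (hcompact : IsCompact {z : X × Set.Ico (0 : ℝ) T | (z.2 : ℝ) ≤ t ∧ u z.1 z.2 ≤ c})
    (hc : 0 < c) (hzero : ∀ x, c ≤ u x 0) {k : ℝ} (hk : 0 ≤ k)
    (hderiv : ∀ s ∈ Set.Ico 0 T, ∀ x, 0 < u x s → (∀ y, u x s ≤ u y s) →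
      ∃ v, HasDerivWithinAt (u x) v (Set.Ico 0 T) s ∧ -k * u x s ≤ v) (x : X) :
    c ≤ Real.exp (k * t) * u x t := by
  have hlim : Tendsto (fun ε => Real.exp (k * t + ε * (t + 1)) * u x t) (𝓝[>] 0)
      (𝓝 (Real.exp (k * t) * u x t)) := by
    have hcont : Continuous fun ε => Real.exp (k * t + ε * (t + 1)) * u x t := by fun_prop
    simpa only [zero_mul, add_zero] using (hcont.tendsto 0).mono_left nhdsWithin_le_nhds
  exact ge_of_tendsto hlim (eventually_mem_nhdsWithin.mono fun ε hε =>
    (lt_exp_mul_of_deriv_ge_at_minima hu ht hcompact hc hzero hk hderiv hε x).le)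

end MaximumPrinciple

section Flow

variable {m : ℕ} {T t : ℝ}

section Dist

variable {N₁ N₂ : Type*} {F₁ : N₁ → ℝ → Minkowski (m + 1)} {F₂ : N₂ → ℝ → Minkowski (m + 1)}

lemma flowDist_le (h₁ : ∀ x, F₁ x t ∈ hyperbolicSpace (m + 1))
    (h₂ : ∀ y, F₂ y t ∈ hyperbolicSpace (m + 1)) (x : N₁) (y : N₂) :
    flowDist F₁ F₂ t ≤ hdist (F₁ x t) (F₂ y t) := by
  refine csInf_le ⟨0, ?_⟩ ⟨_, ⟨x, rfl⟩, _, ⟨y, rfl⟩, rfl⟩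
  rintro _ ⟨_, ⟨z, rfl⟩, _, ⟨w, rfl⟩, rfl⟩
  exact hdist_nonneg (h₁ z) (h₂ w)

lemma flowDist_nonneg (h₁ : ∀ x, F₁ x t ∈ hyperbolicSpace (m + 1))
    (h₂ : ∀ y, F₂ y t ∈ hyperbolicSpace (m + 1)) : 0 ≤ flowDist F₁ F₂ t := by
  refine Real.sInf_nonneg ?_
  rintro _ ⟨_, ⟨x, rfl⟩, _, ⟨y, rfl⟩, rfl⟩
  exact hdist_nonneg (h₁ x) (h₂ y)

lemma le_sinh_half_flowDist [Nonempty N₁] [Nonempty N₂] {r : ℝ}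
    (h : ∀ x y, r ≤ Real.sinh (hdist (F₁ x t) (F₂ y t) / 2)) :
    r ≤ Real.sinh (flowDist F₁ F₂ t / 2) := by
  have hle : 2 * Real.arsinh r ≤ flowDist F₁ F₂ t := by
    refine le_csInf ((Set.range_nonempty _).elim fun p hp =>
      (Set.range_nonempty _).elim fun q hq => ⟨_, p, hp, q, hq, rfl⟩) ?_
    rintro _ ⟨_, ⟨x, rfl⟩, _, ⟨y, rfl⟩, rfl⟩
    have hxy := Real.arsinh_le_arsinh.2 (h x y)
    rw [Real.arsinh_sinh] at hxy
    linarith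
  rw [← Real.sinh_arsinh r, Real.sinh_le_sinh]
  linarith

end Dist

section MCF

variable {N : Type*} [TopologicalSpace N] [ChartedSpace (EuclideanSpace ℝ (Fin m)) N]
  {F : N → ℝ → Minkowski (m + 1)}

lemma IsMCF.contMDiffAt (h : IsMCF T F) (ht : t ∈ Set.Ico 0 T) (x : N) :
    ContMDiffAt (𝓡 m) 𝓘(ℝ, Minkowski (m + 1)) ∞ (fun y => F y t) x :=
  h.smooth.comp_contMDiff (contMDiff_id.prodMk contMDiff_const) (fun _ => ⟨Set.mem_univ _, ht⟩) x

lemma IsMCF.continuous (h : IsMCF T F) : Continuous fun z : N × Set.Ico (0 : ℝ) T => F z.1 z.2 :=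
  h.smooth.continuousOn.comp_continuous (f := fun z : N × Set.Ico (0 : ℝ) T => (z.1, (z.2 : ℝ)))
    (by fun_prop) fun z => ⟨Set.mem_univ _, z.2.2⟩

lemma IsMCF.isHypersurfaceAt (h : IsMCF T F) (ht : t ∈ Set.Ico 0 T) {x : N}
    {ν : Minkowski (m + 1)} (hν : IsUnitNormal (fun y => F y t) x ν) :
    IsHypersurfaceAt (fun y => F y t) x ν where
  contMDiffAt := (h.contMDiffAt ht x).of_le (by norm_cast)
  mem y := h.mem y t ht
  injective := by
    rw [← mfderiv_eq_differential ((h.contMDiffAt ht x).mdifferentiableAt (by simp))]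
    exact h.immersion x t ht
  isUnitNormal := hν

end MCF

variable {N₁ : Type*} [TopologicalSpace N₁] [ChartedSpace (EuclideanSpace ℝ (Fin m)) N₁]
  {N₂ : Type*} [TopologicalSpace N₂] [ChartedSpace (EuclideanSpace ℝ (Fin m)) N₂]
  {F₁ : N₁ → ℝ → Minkowski (m + 1)} {F₂ : N₂ → ℝ → Minkowski (m + 1)}

lemma IsMCF.exists_hasDerivWithinAt_ge_of_isClosestPair (hm : m ≠ 0) (h₁ : IsMCF T F₁)
    (h₂ : IsMCF T F₂) (ht : t ∈ Set.Ico 0 T) {x : N₁} {y : N₂}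
    (hlt : 0 < -lor (F₁ x t) (F₂ y t) - 1)
    (hmin : IsClosestPair (fun z => F₁ z t) (fun w => F₂ w t) x y) :
    ∃ v, HasDerivWithinAt (fun s => -lor (F₁ x s) (F₂ y s) - 1) v (Set.Ico 0 T) t ∧
      -2 * (-lor (F₁ x t) (F₂ y t) - 1) ≤ v := by
  obtain ⟨ν₁, hν₁, hderiv₁⟩ := h₁.flow x t ht
  obtain ⟨ν₂, hν₂, hderiv₂⟩ := h₂.flow y t ht
  refine ⟨_, (hasDerivWithinAt_lor hderiv₁ hderiv₂).fun_neg.sub_const 1, ?_⟩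
  have hcomparison := hmin.meanCurvature_comparison hm (sub_pos.1 hlt)
    (h₁.isHypersurfaceAt ht hν₁) (h₂.isHypersurfaceAt ht hν₂)
  rw [lor_comm (-(_ • ν₁)), lor_neg_right, lor_neg_right, lor_smul_right, lor_smul_right]
  linarith

lemma isCompact_setOf_coe_le (ht : t < T) :
    IsCompact {s : Set.Ico (0 : ℝ) T | (s : ℝ) ≤ t} := by
  have h : IsCompact ((↑) ⁻¹' Set.Icc 0 t : Set (Set.Ico (0 : ℝ) T)) := by
    refine (IsInducing.subtypeVal.isCompact_preimage_iff ?_).2 isCompact_Icc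
    rw [Subtype.range_coe]
    exact Set.Icc_subset_Ico_right ht
  convert h using 1
  ext s
  exact (and_iff_right s.2.1).symm

lemma IsMCF.continuous_neg_lor_sub_one (h₁ : IsMCF T F₁) (h₂ : IsMCF T F₂) :
    Continuous fun z : (N₁ × N₂) × Set.Ico (0 : ℝ) T =>
      -lor (F₁ z.1.1 z.2) (F₂ z.1.2 z.2) - 1 := by
  have hlor := continuous_lor.comp₂
    (h₁.continuous.comp (by fun_prop : Continuous fun z : (N₁ × N₂) × Set.Ico (0 : ℝ) T =>
      (z.1.1, z.2)))
    (h₂.continuous.comp (by fun_prop : Continuous fun z : (N₁ × N₂) × Set.Ico (0 : ℝ) T =>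
      (z.1.2, z.2)))
  exact hlor.neg.sub continuous_const

lemma IsMCF.isCompact_sublevel [CompactSpace N₁] (h₁ : IsMCF T F₁) (h₂ : IsMCF T F₂)
    (hproper : IsProperFlow T F₂) (ht : t < T) (c : ℝ) :
    IsCompact {z : (N₁ × N₂) × Set.Ico (0 : ℝ) T |
      (z.2 : ℝ) ≤ t ∧ -lor (F₁ z.1.1 z.2) (F₂ z.1.2 z.2) - 1 ≤ c} := by
  have htimes := isCompact_setOf_coe_le ht
  obtain ⟨R, hR⟩ := ((isCompact_univ (X := N₁)).prod htimes).bddAbove_image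
    h₁.continuous.fst.continuousOn
  have hpreimage := hproper.isCompact_preimage
    ((isCompact_closedBall (0 : Minkowski (m + 1)) (2 * R * (c + 1))).prod htimes)
  have hprod := (Homeomorph.prodAssoc N₁ N₂ (Set.Ico (0 : ℝ) T)).isCompact_preimage.2
    ((isCompact_univ (X := N₁)).prod hpreimage)
  have htime : Continuous fun z : (N₁ × N₂) × Set.Ico (0 : ℝ) T => (z.2 : ℝ) := by fun_prop
  refine hprod.of_isClosed_subset ((isClosed_le htime continuous_const).inter
    (isClosed_le (h₁.continuous_neg_lor_sub_one h₂) continuous_const)) ?_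
  rintro ⟨⟨x, y⟩, s⟩ ⟨hs, hle⟩
  refine ⟨Set.mem_univ _, mem_closedBall_zero_iff.2 ?_, hs⟩
  have hp := h₁.mem x s s.2
  have hq := h₂.mem y s s.2
  have hbound : (F₁ x s).1 ≤ R := hR ⟨(x, s), ⟨Set.mem_univ _, hs⟩, rfl⟩
  have hlor : -lor (F₁ x s) (F₂ y s) ≤ c + 1 := sub_le_iff_le_add.1 hle
  calc ‖F₂ y s‖ ≤ (F₂ y s).1 := norm_le_fst_of_mem hq
    _ ≤ 2 * (F₁ x s).1 * -lor (F₁ x s) (F₂ y s) := fst_le_two_mul_fst_mul_neg_lor hp hq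
    _ ≤ 2 * R * (c + 1) := by
      have h := one_le_neg_lor hp hq
      gcongr
      linarith [hp.2]

theorem IsMCF.le_exp_mul_neg_lor_sub_one [CompactSpace N₁] (hm : m ≠ 0) (h₁ : IsMCF T F₁)
    (h₂ : IsMCF T F₂) (hproper : IsProperFlow T F₂) (ht : t ∈ Set.Ico 0 T) {c : ℝ} (hc : 0 < c)
    (hzero : ∀ x y, c ≤ -lor (F₁ x 0) (F₂ y 0) - 1) (x : N₁) (y : N₂) :
    c ≤ Real.exp (2 * t) * (-lor (F₁ x t) (F₂ y t) - 1) := by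
  refine le_exp_mul_of_deriv_ge_at_minima (X := N₁ × N₂)
    (u := fun z s => -lor (F₁ z.1 s) (F₂ z.2 s) - 1) (h₁.continuous_neg_lor_sub_one h₂) ht
    (h₁.isCompact_sublevel h₂ hproper ht.2 c) hc (fun z => hzero z.1 z.2) zero_le_two
    (fun s hs z hpos hmin => ?_) (x, y)
  refine h₁.exists_hasDerivWithinAt_ge_of_isClosestPair hm h₂ hs hpos fun x' y' => ?_
  linarith [hmin (x', y')]

theorem IsMCF.le_exp_mul_sinh_half_hdist [CompactSpace N₁] (hm : m ≠ 0) (h₁ : IsMCF T F₁)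
    (h₂ : IsMCF T F₂) (hproper : IsProperFlow T F₂) (ht : t ∈ Set.Ico 0 T) {r : ℝ} (hr : 0 < r)
    (hzero : ∀ x y, r ≤ Real.sinh (hdist (F₁ x 0) (F₂ y 0) / 2)) (x : N₁) (y : N₂) :
    r ≤ Real.exp t * Real.sinh (hdist (F₁ x t) (F₂ y t) / 2) := by
  have hT : (0 : ℝ) ∈ Set.Ico 0 T := ⟨le_rfl, ht.1.trans_lt ht.2⟩
  have hinitial (z : N₁) (w : N₂) : 2 * r ^ 2 ≤ -lor (F₁ z 0) (F₂ w 0) - 1 := by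
    rw [← two_mul_sinh_half_hdist_sq (h₁.mem z 0 hT) (h₂.mem w 0 hT)]
    have h := hzero z w
    gcongr
  have hlater := h₁.le_exp_mul_neg_lor_sub_one hm h₂ hproper ht (by positivity) hinitial x y
  have hp := h₁.mem x t ht
  have hq := h₂.mem y t ht
  rw [← two_mul_sinh_half_hdist_sq hp hq, two_mul t, Real.exp_add] at hlater
  have hsinh : 0 ≤ Real.sinh (hdist (F₁ x t) (F₂ y t) / 2) :=
    Real.sinh_nonneg_iff.2 (div_nonneg (hdist_nonneg hp hq) zero_le_two)
  refine le_of_sq_le_sq ?_ (by positivity)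
  linarith

theorem IsMCF.sinh_half_flowDist_zero_le [CompactSpace N₁] [Nonempty N₁] [Nonempty N₂]
    (hm : m ≠ 0) (h₁ : IsMCF T F₁) (h₂ : IsMCF T F₂) (hproper : IsProperFlow T F₂)
    (ht : t ∈ Set.Ico 0 T) :
    Real.sinh (flowDist F₁ F₂ 0 / 2) ≤ Real.exp t * Real.sinh (flowDist F₁ F₂ t / 2) := by
  have hT : (0 : ℝ) ∈ Set.Ico 0 T := ⟨le_rfl, ht.1.trans_lt ht.2⟩
  have hle (x : N₁) (y : N₂) : flowDist F₁ F₂ 0 ≤ hdist (F₁ x 0) (F₂ y 0) :=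
    flowDist_le (fun z => h₁.mem z 0 hT) (fun w => h₂.mem w 0 hT) x y
  have hnonneg := flowDist_nonneg (fun x => h₁.mem x t ht) fun y => h₂.mem y t ht
  obtain hneg | hpos := le_or_gt (Real.sinh (flowDist F₁ F₂ 0 / 2)) 0
  · exact hneg.trans (mul_nonneg (Real.exp_pos t).le
      (Real.sinh_nonneg_iff.2 (div_nonneg hnonneg zero_le_two)))
  rw [← inv_mul_le_iff₀ (Real.exp_pos t)]
  refine le_sinh_half_flowDist fun x y => (inv_mul_le_iff₀ (Real.exp_pos t)).2 ?_
  refine h₁.le_exp_mul_sinh_half_hdist hm h₂ hproper ht hpos (fun z w => ?_) x y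
  exact Real.sinh_le_sinh.2 (div_le_div_of_nonneg_right (hle z w) zero_le_two)

theorem IsMCF.flowDist_zero_le [CompactSpace N₁] [Nonempty N₁] [Nonempty N₂] (hm : m ≠ 0)
    (h₁ : IsMCF T F₁) (h₂ : IsMCF T F₂) (hproper : IsProperFlow T F₂) (ht : t ∈ Set.Ico 0 T) :
    flowDist F₁ F₂ 0 ≤ Real.exp t * flowDist F₁ F₂ t := by
  have hnonneg := flowDist_nonneg (fun x => h₁.mem x t ht) fun y => h₂.mem y t ht
  have hsinh := (h₁.sinh_half_flowDist_zero_le hm h₂ hproper ht).trans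
    (mul_sinh_le_sinh_mul (Real.one_le_exp ht.1) (div_nonneg hnonneg zero_le_two))
  linarith [Real.sinh_le_sinh.1 hsinh]

end Flow

end HypMCF

theorem theorem3p1 (m : ℕ) (hm : 1 ≤ m)
    {N₁ : Type*} [TopologicalSpace N₁] [T2Space N₁] [SecondCountableTopology N₁] [Nonempty N₁]
    [ChartedSpace (EuclideanSpace ℝ (Fin m)) N₁] [IsManifold (𝓡 m) ∞ N₁] [CompactSpace N₁]
    {N₂ : Type*} [TopologicalSpace N₂] [T2Space N₂] [SecondCountableTopology N₂] [Nonempty N₂]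
    [ChartedSpace (EuclideanSpace ℝ (Fin m)) N₂] [IsManifold (𝓡 m) ∞ N₂]
    (T : ℝ) (F₁ : N₁ → ℝ → HypMCF.Minkowski (m + 1)) (F₂ : N₂ → ℝ → HypMCF.Minkowski (m + 1))
    (h₁ : HypMCF.IsMCF T F₁) (h₂ : HypMCF.IsMCF T F₂) (hproper : HypMCF.IsProperFlow T F₂)
    (t : ℝ) (ht : t ∈ Set.Ico 0 T) :
    Real.sinh (HypMCF.flowDist F₁ F₂ 0 / 2)
        ≤ Real.exp t * Real.sinh (HypMCF.flowDist F₁ F₂ t / 2) ∧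
      HypMCF.flowDist F₁ F₂ 0 ≤ Real.exp t * HypMCF.flowDist F₁ F₂ t :=
  ⟨h₁.sinh_half_flowDist_zero_le (Nat.ne_of_gt hm) h₂ hproper ht,
    h₁.flowDist_zero_le (Nat.ne_of_gt hm) h₂ hproper ht⟩
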